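/- For real $\theta$ let $\mathbb C_\theta=\{s\in\mathbb C:\operatorname{Re}s>\theta\}$ and $\mathbb C_+=\mathbb C_0$. Let $\mathcal D$ denote the set of functions that on some half-plane $\mathbb C_\theta$ are the sum of a convergent Dirichlet series $\sum_{n\ge1}a_nn^{-s}$. For $\varepsilon\ge 0$ let $\mathcal H^\infty(\mathbb C_\varepsilon)$ be the set of bounded analytic functions on $\mathbb C_\varepsilon$ that can be written as a convergent Dirichlet series in some half-plane. The Gordon–Hedenmalm class $\mathcal G$ consists of the analytic maps $\Phi:\mathbb C_+\to\mathbb C_+$ of the form $\Phi(s)=c\,s+\varphi(s)$, $s\in\mathbb C_+$, with $c\in\mathbb N\cup\{0\}$ and $\varphi\in\mathcal D$, such that $\Phi(\mathbb C_+)\subset\mathbb C_{1/2}$ in case $c=0$. A continuous semigroup is a family $\{\Phi_t\}_{t\ge0}$ of analytic maps $\Phi_t:\mathbb C_+\to\mathbb C_+$ with $\Phi_0(s)=s$, $\Phi_t\circ\Phi_u=\Phi_{t+u}$ for all $t,u\ge0$, and $\Phi_t\to\Phi_0$ uniformly on compact subsets of $\mathbb C_+$ as $t\to0^+$; its infinitesimal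 generator is $H(s)=\lim_{t\to0^+}\frac{\Phi_t(s)-s}{t}$, $s\in\mathbb C_+$, the limit being uniform on compact subsets of $\mathbb C_+$. **Theorem.** Let $H:\mathbb C_+\to\overline{\mathbb C_+}$ be analytic and such that $H\in\mathcal H^\infty(\mathbb C_{1/2+\sigma})$ for every $\sigma>0$. Then $H$ is the infinitesimal generator of a continuous semigroup $\{\Phi_t\}_{t\ge0}$ such that, for every $t\ge0$, $$\Phi_t(s)=s+\varphi_t(s),\qquad s\in\mathbb C_+,$$ with $\varphi_t\in\mathcal D$; that is, $\{\Phi_t\}_{t\ge0}$ is a continuous semigroup in the class $\mathcal G$. -/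

import Mathlib

open Filter Topology

/-- The open right half-plane `ℂ_θ = {s : Re s > θ}`; `ℂ_+` is `rightHalfPlane 0`. -/
def rightHalfPlane (θ : ℝ) : Set ℂ := {s : ℂ | θ < s.re}

/-- `f` can be written as a Dirichlet series `∑_{n ≥ 1} a_n n^{-s}` in a certain half-plane:
on some `ℂ_θ` the series converges (as a limit of partial sums, possibly only conditionally)
and its sum is `f`. -/
def IsDirichletSeries (f : ℂ → ℂ) : Prop :=
  ∃ (a : ℕ → ℂ) (θ : ℝ), ∀ s ∈ rightHalfPlane θ,
    Tendsto (fun N : ℕ => ∑ n ∈ Finset.Icc 1 N, a n * (n : ℂ) ^ (-s)) atTop (𝓝 (f s))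

/-- `f` (restricted to `ℂ_ε`) belongs to `𝓗^∞(ℂ_ε)`: it is analytic and bounded in `ℂ_ε`, and
can be written as a Dirichlet series in a certain half-plane. -/
structure MemHInfty (ε : ℝ) (f : ℂ → ℂ) : Prop where
  analytic : DifferentiableOn ℂ f (rightHalfPlane ε)
  bounded : ∃ M : ℝ, ∀ s ∈ rightHalfPlane ε, ‖f s‖ ≤ M
  dirichlet : IsDirichletSeries f

/-- `Φ` (restricted to `ℂ_+`) is an analytic self-map of `ℂ_+`. -/
structure IsAnalyticSelfMap (Φ : ℂ → ℂ) : Prop where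
  analytic : DifferentiableOn ℂ Φ (rightHalfPlane 0)
  mapsTo : Set.MapsTo Φ (rightHalfPlane 0) (rightHalfPlane 0)

/-- The Gordon–Hedenmalm class: analytic `Φ : ℂ_+ → ℂ_+` of the form `Φ(s) = c s + φ(s)` with
`c` a nonnegative integer and `φ` a Dirichlet series, where `Φ(ℂ_+) ⊆ ℂ_{1/2}` in case `c = 0`. -/
structure MemGordonHedenmalm (Φ : ℂ → ℂ) : Prop where
  selfMap : IsAnalyticSelfMap Φ
  form : ∃ (c : ℕ) (φ : ℂ → ℂ), IsDirichletSeries φ ∧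
    (∀ s ∈ rightHalfPlane 0, Φ s = c * s + φ s) ∧
    (c = 0 → Set.MapsTo Φ (rightHalfPlane 0) (rightHalfPlane (1 / 2)))

/-- `{Φ_t}_{t ≥ 0}` is a continuous semigroup of analytic self-maps of `ℂ_+`. Only the values
`Φ t s` with `0 ≤ t` and `s ∈ ℂ_+` matter. -/
structure IsContinuousSemigroup (Φ : ℝ → ℂ → ℂ) : Prop where
  selfMap : ∀ t : ℝ, 0 ≤ t → IsAnalyticSelfMap (Φ t)
  zero : ∀ s ∈ rightHalfPlane 0, Φ 0 s = s
  comp : ∀ t u : ℝ, 0 ≤ t → 0 ≤ u → ∀ s ∈ rightHalfPlane 0, Φ t (Φ u s) = Φ (t + u) s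
  continuous : ∀ K : Set ℂ, K ⊆ rightHalfPlane 0 → IsCompact K →
    TendstoUniformlyOn Φ (Φ 0) (𝓝[>] 0) K

/-- `H` is the infinitesimal generator of `{Φ_t}_{t ≥ 0}`:
`H(s) = lim_{t → 0⁺} (Φ_t(s) - s) / t`, uniformly on compact subsets of `ℂ_+`. -/
def IsInfinitesimalGenerator (H : ℂ → ℂ) (Φ : ℝ → ℂ → ℂ) : Prop :=
  ∀ K : Set ℂ, K ⊆ rightHalfPlane 0 → IsCompact K →
    TendstoUniformlyOn (fun (t : ℝ) (s : ℂ) => (Φ t s - s) / (t : ℂ)) H (𝓝[>] 0) K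

/-! Since `Re H ≥ 0` and `H` is bounded on `ℂ_1`, the Borel–Carathéodory inequality bounds `H` on
every `ℂ_ε` with `ε > 0`, and Cauchy's estimate makes it Lipschitz there. Trajectories of `x' =
H(x)` move to the right, so they never approach the imaginary axis and exist for all `t ≥ 0`; they
form the semigroup.

The explicit Euler iterates converge to this flow uniformly on each `ℂ_ε`
(`tendstoUniformlyOn_eulerStep`). This carries over to `Φ_t` both analyticity and the Dirichlet
series form. For the latter, `∑ |c_i| m_i^{-σ}` serves as a norm: it is submultiplicative, and
composing `H` with `s + ψ(s)` costs only a shift of `σ` by the norm of `ψ`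
(`comp_mem_dirichletBall`). Hence all Euler displacements up to time `t` lie in one ball, whatever
the step size. The ball is closed under pointwise limits, and compactness of the set of admissible
coefficients shows that its elements are genuine Dirichlet series
(`exists_hasSum_of_mem_dirichletBall`). -/

open scoped NNReal

/-! ### Global solutions of ordinary differential equations. -/

/-- A bounded globally Lipschitz vector field has a solution defined for all times. -/
theorem exists_hasDerivAt_of_lipschitzWith_of_bounded {E : Type*} [NormedAddCommGroup E]
    [NormedSpace ℝ E] [CompleteSpace E] {v : E → E} {K L : ℝ≥0}
    (hK : LipschitzWith K v) (hL : ∀ z, ‖v z‖ ≤ L) (x₀ : E) :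
    ∃ x : ℝ → E, x 0 = x₀ ∧ ∀ t, HasDerivAt x (v (x t)) t := by
  have h : ∀ n : ℕ, ∃ x : ℝ → E, x 0 = x₀ ∧
      ∀ t ∈ Set.Ioo (-((n : ℝ) + 1)) (n + 1), HasDerivAt x (v (x t)) t := by
    intro n
    have hn : (0 : ℝ) < n + 1 := by positivity
    -- At speed at most `L`, a solution cannot leave the ball of radius `L (n + 1)` within time `n +
    -- 1`.
    have hP : IsPicardLindelof (fun _ => v)
        (⟨0, by constructor <;> linarith⟩ : Set.Icc (-((n : ℝ) + 1)) (n + 1)) x₀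
        (L * (n + 1)) 0 L K :=
      IsPicardLindelof.of_time_independent (fun x _ => hL x) hK.lipschitzOnWith (by simp)
    obtain ⟨x, hx0, hx⟩ := hP.exists_eq_forall_mem_Icc_hasDerivWithinAt₀
    exact ⟨x, hx0, fun t ht => (hx t (Set.Ioo_subset_Icc_self ht)).hasDerivAt
      (Icc_mem_nhds ht.1 ht.2)⟩
  choose X hX0 hX using h
  have hle : ∀ m n : ℕ, m ≤ n → ∀ t ∈ Set.Ioo (-((m : ℝ) + 1)) (m + 1), X m t = X n t := by
    intro m n hmn t ht
    have hm : (0 : ℝ) < m + 1 := by positivity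
    have hmn' : (m : ℝ) ≤ n := by exact_mod_cast hmn
    refine ODE_solution_unique_of_mem_Ioo (v := fun _ => v) (s := fun _ => Set.univ) (K := K)
      (t₀ := 0) (fun _ _ => hK.lipschitzOnWith) ⟨by linarith, hm⟩
      (fun u hu => ⟨hX m u hu, trivial⟩)
      (fun u hu => ⟨hX n u ⟨by linarith [hu.1], by linarith [hu.2]⟩, trivial⟩) ?_ ht
    rw [hX0, hX0]
  have hglue : ∀ (n : ℕ) (t : ℝ), t ∈ Set.Ioo (-((n : ℝ) + 1)) (n + 1) →
      X ⌈|t|⌉₊ t = X n t := by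
    intro n t ht
    have hk : t ∈ Set.Ioo (-((⌈|t|⌉₊ : ℝ) + 1)) (⌈|t|⌉₊ + 1) := by
      have := Nat.le_ceil |t|
      constructor <;> linarith [neg_abs_le t, le_abs_self t]
    rcases le_total n ⌈|t|⌉₊ with hc | hc
    · exact (hle _ _ hc t ht).symm
    · exact hle _ _ hc t hk
  refine ⟨fun t => X ⌈|t|⌉₊ t, by simp [hX0], fun t => ?_⟩
  have ht : t ∈ Set.Ioo (-((⌈|t|⌉₊ : ℝ) + 1)) (⌈|t|⌉₊ + 1) := by
    have := Nat.le_ceil |t|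
    constructor <;> linarith [neg_abs_le t, le_abs_self t]
  exact (hX _ t ht).congr_of_eventuallyEq
    (Filter.eventually_of_mem (Ioo_mem_nhds ht.1 ht.2) fun u hu => hglue _ u hu)

/-! ### Half-planes, and bounds for functions with nonnegative real part. -/

theorem isOpen_rightHalfPlane (θ : ℝ) : IsOpen (rightHalfPlane θ) :=
  isOpen_lt continuous_const Complex.continuous_re

theorem convex_rightHalfPlane (θ : ℝ) : Convex ℝ (rightHalfPlane θ) :=
  convex_halfSpace_re_gt θ

theorem re_nonneg_of_mem_closure_rightHalfPlane {z : ℂ} (hz : z ∈ closure (rightHalfPlane 0)) :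
    0 ≤ z.re :=
  closure_minimal (t := {z : ℂ | 0 ≤ z.re}) (fun _ h => le_of_lt (a := (0 : ℝ)) h)
    (isClosed_le continuous_const Complex.continuous_re : IsClosed {z : ℂ | 0 ≤ z.re}) hz

/-- An analytic function with nonnegative real part on `ℂ_+` which is bounded on `ℂ_1` is bounded
on every smaller half-plane `ℂ_ε`. -/
theorem bounded_of_re_nonneg {H : ℂ → ℂ} (hH : DifferentiableOn ℂ H (rightHalfPlane 0))
    (hre : ∀ s ∈ rightHalfPlane 0, 0 ≤ (H s).re) {B : ℝ}
    (hB : ∀ s ∈ rightHalfPlane 1, ‖H s‖ ≤ B) {ε : ℝ} (hε : 0 < ε) :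
    ∃ C : ℝ, ∀ s ∈ rightHalfPlane ε, ‖H s‖ ≤ C := by
  -- Borel–Carathéodory for `-H` on the disc of radius `R = 1 + ε` about `s + 1`, evaluated at
  -- distance `r = 1`, with the upper bound `1` for the real part.
  refine ⟨2 * 1 * 1 / ε + B * (2 + ε) / ε, fun s hs => ?_⟩
  have hs' : ε < s.re := hs
  have hmem : ∀ z ∈ Metric.ball (0 : ℂ) (1 + ε), s + 1 + z ∈ rightHalfPlane 0 := by
    intro z hz
    have := (Complex.abs_re_le_norm z).trans_lt (mem_ball_zero_iff.mp hz)
    have := neg_abs_le z.re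
    simp only [rightHalfPlane, Set.mem_ofPred_eq, Complex.add_re, Complex.one_re]
    linarith
  have hd : DifferentiableOn ℂ (fun z => -H (s + 1 + z)) (Metric.ball 0 (1 + ε)) :=
    (hH.comp (by fun_prop) hmem).neg
  have := Complex.borelCaratheodory (z := -1) one_pos hd
    (fun z hz => by
      have := hre _ (hmem z hz)
      simp only [Set.mem_ofPred_eq, Complex.neg_re]
      linarith) (by linarith) (by simpa using hε)
  simp only [norm_neg, norm_one, add_zero, add_neg_cancel_right, add_sub_cancel_left] at this
  refine this.trans ?_
  have h1 : ‖H (s + 1)‖ ≤ B := hB _ (by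
    simp only [rightHalfPlane, Set.mem_ofPred_eq, Complex.add_re, Complex.one_re]; linarith)
  have h2 : 1 + ε + 1 = 2 + ε := by ring
  rw [h2]
  gcongr

/-- A function which is bounded and analytic on `ℂ_ε` is Lipschitz on `ℂ_{ε'}` for `ε' > ε`. -/
theorem lipschitzOnWith_of_bounded {H : ℂ → ℂ} {ε ε' : ℝ} (h : ε < ε')
    (hH : DifferentiableOn ℂ H (rightHalfPlane ε)) {B : ℝ}
    (hB : ∀ s ∈ rightHalfPlane ε, ‖H s‖ ≤ B) :
    ∃ K : ℝ≥0, LipschitzOnWith K H (rightHalfPlane ε') := by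
  refine ⟨(B / (ε' - ε)).toNNReal,
    (convex_rightHalfPlane ε').lipschitzOnWith_of_nnnorm_deriv_le (𝕜 := ℂ)
    (fun s hs => hH.differentiableAt ((isOpen_rightHalfPlane ε).mem_nhds (h.trans hs))) ?_⟩
  intro s hs
  have hs' : ε' < s.re := hs
  rw [← NNReal.coe_le_coe, coe_nnnorm]
  refine le_trans ?_ (Real.le_coe_toNNReal _)
  have hsub : Metric.closedBall s (ε' - ε) ⊆ rightHalfPlane ε := by
    intro z hz
    have h1 := (Complex.abs_re_le_norm (z - s)).trans (mem_closedBall_iff_norm.mp hz)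
    have h2 := neg_abs_le (z - s).re
    rw [Complex.sub_re] at h1 h2
    change ε < z.re
    linarith
  refine Complex.norm_deriv_le_of_forall_mem_sphere_norm_le (sub_pos.2 h)
    (DifferentiableOn.diffContOnCl_ball hH hsub) fun z hz =>
      hB z (hsub (Metric.sphere_subset_closedBall hz))

/-! ### Trajectories of `H`. -/

/-- `x` is a forward trajectory of the vector field `H`, along which the real part does not
decrease. -/
structure IsForwardTrajectory (H : ℂ → ℂ) (x : ℝ → ℂ) : Prop where
  hasDerivAt : ∀ t : ℝ, 0 ≤ t → HasDerivAt x (H (x t)) t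
  monotoneOn : MonotoneOn (fun t => (x t).re) (Set.Ici 0)

/-- Analytic vector fields on `ℂ_+` which point to the right and which are bounded and Lipschitz
on every smaller half-plane. -/
structure IsTameField (H : ℂ → ℂ) : Prop where
  analytic : DifferentiableOn ℂ H (rightHalfPlane 0)
  re_nonneg : ∀ s ∈ rightHalfPlane 0, 0 ≤ (H s).re
  bounded : ∀ ε : ℝ, 0 < ε → ∃ C : ℝ≥0, ∀ s ∈ rightHalfPlane ε, ‖H s‖ ≤ C
  lipschitz : ∀ ε : ℝ, 0 < ε → ∃ K : ℝ≥0, LipschitzOnWith K H (rightHalfPlane ε)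

theorem isTameField_of_re_nonneg {H : ℂ → ℂ} (hH : DifferentiableOn ℂ H (rightHalfPlane 0))
    (hre : ∀ s ∈ rightHalfPlane 0, 0 ≤ (H s).re) {B : ℝ}
    (hB : ∀ s ∈ rightHalfPlane 1, ‖H s‖ ≤ B) : IsTameField H where
  analytic := hH
  re_nonneg := hre
  bounded ε hε := by
    obtain ⟨C, hC⟩ := bounded_of_re_nonneg hH hre hB hε
    exact ⟨C.toNNReal, fun s hs => (hC s hs).trans (Real.le_coe_toNNReal _)⟩
  lipschitz ε hε := by
    obtain ⟨C, hC⟩ := bounded_of_re_nonneg hH hre hB (half_pos hε)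
    exact lipschitzOnWith_of_bounded (half_lt_self hε)
      (hH.mono fun s (hs : ε / 2 < s.re) => (half_pos hε).trans hs) hC

namespace IsTameField

variable {H : ℂ → ℂ}

theorem exists_trajectory (hH : IsTameField H) {s : ℂ} (hs : s ∈ rightHalfPlane 0) :
    ∃ x : ℝ → ℂ, x 0 = s ∧ IsForwardTrajectory H x := by
  have hs' : 0 < s.re := hs
  obtain ⟨C, hC⟩ := hH.bounded _ (half_pos hs')
  obtain ⟨K, hK⟩ := hH.lipschitz _ (half_pos hs')
  -- `p` retracts the plane onto `Re z ≥ Re s`, so `H ∘ p` is globally bounded and Lipschitz. Its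
  -- solution from `s` moves to the right, where `p` is the identity, and thus solves the equation
  -- for `H` itself.
  set p : ℂ → ℂ := fun z => z + ((max (s.re - z.re) 0 : ℝ) : ℂ) with hp
  have hpre : ∀ z, s.re ≤ (p z).re := by
    intro z
    have := le_max_left (s.re - z.re) 0
    simp only [hp, Complex.add_re, Complex.ofReal_re]
    linarith
  have hpmem : ∀ z, p z ∈ rightHalfPlane (s.re / 2) := fun z =>
    (half_lt_self hs').trans_le (hpre z)
  have hpid : ∀ z, s.re ≤ z.re → p z = z := by
    intro z hz
    simp [hp, max_eq_right (sub_nonpos.2 hz)]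
  have hplip : LipschitzWith 2 p := by
    refine LipschitzWith.of_dist_le_mul fun z w => ?_
    have h1 : |max (s.re - z.re) 0 - max (s.re - w.re) 0| ≤ ‖z - w‖ := by
      refine (abs_max_sub_max_le_abs _ _ _).trans ?_
      rw [show s.re - z.re - (s.re - w.re) = -(z - w).re by simp, abs_neg]
      exact Complex.abs_re_le_norm _
    rw [dist_eq_norm, dist_eq_norm, show p z - p w = (z - w) +
      ((max (s.re - z.re) 0 - max (s.re - w.re) 0 : ℝ) : ℂ) by simp only [hp]; push_cast; ring]
    refine (norm_add_le _ _).trans ?_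
    rw [Complex.norm_real, Real.norm_eq_abs]
    change _ ≤ (2 : ℝ) * _
    linarith
  have hv : LipschitzWith (K * 2) (H ∘ p) := by
    rw [← lipschitzOnWith_univ]
    exact hK.comp hplip.lipschitzOnWith fun z _ => hpmem z
  obtain ⟨x, hx0, hx⟩ := exists_hasDerivAt_of_lipschitzWith_of_bounded hv
    (fun z => hC _ (hpmem z)) s
  have hmono : Monotone fun t => (x t).re := by
    have hd : ∀ t, HasDerivAt (fun t => (x t).re) (H (p (x t))).re t := fun t =>
      Complex.reCLM.hasFDerivAt.comp_hasDerivAt t (hx t)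
    refine monotone_of_deriv_nonneg (fun t => (hd t).differentiableAt) fun t => ?_
    rw [(hd t).deriv]
    exact hH.re_nonneg _ (hs'.trans_le (hpre _))
  refine ⟨x, hx0, fun t ht => ?_, hmono.monotoneOn _⟩
  have h1 := hx t
  rwa [Function.comp_apply, hpid (x t) (by simpa [hx0] using hmono ht)] at h1

end IsTameField

namespace IsForwardTrajectory

variable {H : ℂ → ℂ} {x y : ℝ → ℂ}

theorem shift (hx : IsForwardTrajectory H x) {u : ℝ} (hu : 0 ≤ u) :
    IsForwardTrajectory H fun t => x (t + u) where
  hasDerivAt t ht := (hx.hasDerivAt (t + u) (add_nonneg ht hu)).comp_add_const t u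
  monotoneOn _ ha _ hb hab :=
    hx.monotoneOn (add_nonneg ha hu) (add_nonneg hb hu) (add_le_add_left hab u)

theorem continuousOn (hx : IsForwardTrajectory H x) (b : ℝ) : ContinuousOn x (Set.Icc 0 b) :=
  fun t ht => (hx.hasDerivAt t ht.1).continuousAt.continuousWithinAt

theorem mem (hx : IsForwardTrajectory H x) {ε : ℝ} (h : x 0 ∈ rightHalfPlane ε) {t : ℝ}
    (ht : 0 ≤ t) : x t ∈ rightHalfPlane ε :=
  lt_of_lt_of_le (α := ℝ) h (hx.monotoneOn Set.self_mem_Ici ht ht)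

theorem eq_of_eq_zero (hH : IsTameField H) (hx : IsForwardTrajectory H x)
    (hy : IsForwardTrajectory H y) (h0 : x 0 ∈ rightHalfPlane 0) (hxy : x 0 = y 0) {t : ℝ}
    (ht : 0 ≤ t) : x t = y t := by
  have hs : (0 : ℝ) < (x 0).re := h0
  obtain ⟨K, hK⟩ := hH.lipschitz _ (half_pos hs)
  have hmem : x 0 ∈ rightHalfPlane ((x 0).re / 2) := half_lt_self hs
  exact ODE_solution_unique_of_mem_Icc_right (v := fun _ => H)
    (s := fun _ => rightHalfPlane ((x 0).re / 2)) (fun _ _ => hK)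
    (hx.continuousOn t) (fun u hu => (hx.hasDerivAt u hu.1).hasDerivWithinAt)
    (fun u hu => hx.mem hmem hu.1)
    (hy.continuousOn t) (fun u hu => (hy.hasDerivAt u hu.1).hasDerivWithinAt)
    (fun u hu => hy.mem (hxy ▸ hmem) hu.1) hxy ⟨ht, le_rfl⟩

theorem norm_sub_le (hx : IsForwardTrajectory H x) {ε : ℝ} {C : ℝ≥0}
    (hC : ∀ s ∈ rightHalfPlane ε, ‖H s‖ ≤ C) (h0 : x 0 ∈ rightHalfPlane ε) {t : ℝ} (ht : 0 ≤ t) :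
    ‖x t - x 0‖ ≤ C * t := by
  simpa using norm_image_sub_le_of_norm_deriv_right_le_segment (hx.continuousOn t)
    (fun u hu => (hx.hasDerivAt u hu.1).hasDerivWithinAt)
    (fun u hu => hC _ (hx.mem h0 hu.1)) t ⟨ht, le_rfl⟩

/-- The error of one step of the explicit Euler method is quadratic in the step size. -/
theorem norm_sub_euler_le (hx : IsForwardTrajectory H x) {ε : ℝ} {C K : ℝ≥0}
    (hC : ∀ s ∈ rightHalfPlane ε, ‖H s‖ ≤ C) (hK : LipschitzOnWith K H (rightHalfPlane ε))
    (h0 : x 0 ∈ rightHalfPlane ε) {t : ℝ} (ht : 0 ≤ t) :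
    ‖x t - (x 0 + t * H (x 0))‖ ≤ K * C * t ^ 2 := by
  have hd : ∀ u : ℝ, 0 ≤ u →
      HasDerivAt (fun u : ℝ => x u - u * H (x 0)) (H (x u) - H (x 0)) u := by
    intro u hu
    have : HasDerivAt (fun u : ℝ => x u - u * H (x 0)) (H (x u) - 1 * H (x 0)) u :=
      (hx.hasDerivAt u hu).sub ((Complex.ofRealCLM.hasDerivAt (x := u)).mul_const (H (x 0)))
    rwa [one_mul] at this
  have hb : ∀ u ∈ Set.Ico 0 t, ‖H (x u) - H (x 0)‖ ≤ K * C * t := by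
    intro u hu
    have h1 := hK.dist_le_mul _ (hx.mem h0 hu.1) _ h0
    rw [dist_eq_norm, dist_eq_norm] at h1
    refine h1.trans ?_
    rw [mul_assoc]
    gcongr
    exact (hx.norm_sub_le hC h0 hu.1).trans (by gcongr; exact hu.2.le)
  have := norm_image_sub_le_of_norm_deriv_right_le_segment
    (f := fun u : ℝ => x u - u * H (x 0)) (a := 0) (b := t)
    (fun u hu => (hd u hu.1).continuousAt.continuousWithinAt)
    (fun u hu => (hd u hu.1).hasDerivWithinAt) hb t ⟨ht, le_rfl⟩
  calc ‖x t - (x 0 + t * H (x 0))‖ = ‖x t - t * H (x 0) - (x 0 - (0 : ℝ) * H (x 0))‖ := by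
        congr 1; push_cast; ring
    _ ≤ K * C * t * (t - 0) := this
    _ = K * C * t ^ 2 := by ring

end IsForwardTrajectory

/-! ### The flow and the convergence of Euler's method. -/

/-- `Φ` is the forward flow of the vector field `H` on `ℂ_+`. -/
structure IsForwardFlow (H : ℂ → ℂ) (Φ : ℝ → ℂ → ℂ) : Prop where
  zero : ∀ s ∈ rightHalfPlane 0, Φ 0 s = s
  trajectory : ∀ s ∈ rightHalfPlane 0, IsForwardTrajectory H fun t => Φ t s

theorem IsTameField.exists_isForwardFlow {H : ℂ → ℂ} (hH : IsTameField H) :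
    ∃ Φ : ℝ → ℂ → ℂ, IsForwardFlow H Φ := by
  choose! x hx0 hx using fun s (hs : s ∈ rightHalfPlane 0) => hH.exists_trajectory hs
  exact ⟨fun t s => x s t, hx0, hx⟩

theorem exists_subset_rightHalfPlane {K : Set ℂ} (hK : K ⊆ rightHalfPlane 0) (hc : IsCompact K) :
    ∃ ε : ℝ, 0 < ε ∧ K ⊆ rightHalfPlane ε := by
  rcases K.eq_empty_or_nonempty with rfl | hne
  · exact ⟨1, one_pos, Set.empty_subset _⟩
  · obtain ⟨z, hz, hmin⟩ := hc.exists_isMinOn hne Complex.continuous_re.continuousOn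
    have hz0 : 0 < z.re := hK hz
    exact ⟨z.re / 2, half_pos hz0, fun w hw => (half_lt_self hz0).trans_le (hmin hw)⟩

theorem rightHalfPlane_subset {ε ε' : ℝ} (h : ε ≤ ε') : rightHalfPlane ε' ⊆ rightHalfPlane ε :=
  fun s (hs : ε' < s.re) => (h.trans_lt hs : ε < s.re)

/-- One step of size `h` of the explicit Euler method for the vector field `H`. -/
noncomputable def eulerStep (H : ℂ → ℂ) (h : ℝ) (s : ℂ) : ℂ := s + h * H s

namespace IsTameField

variable {H : ℂ → ℂ}

theorem mapsTo_eulerStep (hH : IsTameField H) {ε h : ℝ} (hε : 0 ≤ ε) (hh : 0 ≤ h) :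
    Set.MapsTo (eulerStep H h) (rightHalfPlane ε) (rightHalfPlane ε) := by
  intro s hs
  have h1 := hH.re_nonneg s (rightHalfPlane_subset hε hs)
  have hs' : ε < s.re := hs
  have : 0 ≤ h * (H s).re := mul_nonneg hh h1
  change ε < (eulerStep H h s).re
  simp only [eulerStep, Complex.add_re, Complex.re_ofReal_mul]
  linarith

theorem differentiableOn_iterate_eulerStep (hH : IsTameField H) {h : ℝ} (hh : 0 ≤ h) (k : ℕ) :
    DifferentiableOn ℂ (eulerStep H h)^[k] (rightHalfPlane 0) := by
  have hd : DifferentiableOn ℂ (eulerStep H h) (rightHalfPlane 0) :=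
    differentiableOn_id.add (hH.analytic.const_mul _)
  exact hd.iterate (hH.mapsTo_eulerStep le_rfl hh) k

end IsTameField

namespace IsForwardFlow

variable {H : ℂ → ℂ} {Φ : ℝ → ℂ → ℂ}

theorem mem (hΦ : IsForwardFlow H Φ) {ε t : ℝ} (hε : 0 ≤ ε) (ht : 0 ≤ t) {s : ℂ}
    (hs : s ∈ rightHalfPlane ε) : Φ t s ∈ rightHalfPlane ε := by
  have hs0 := rightHalfPlane_subset hε hs
  exact (hΦ.trajectory s hs0).mem (by simpa only [hΦ.zero s hs0] using hs) ht

theorem comp (hH : IsTameField H) (hΦ : IsForwardFlow H Φ) {t u : ℝ} (ht : 0 ≤ t) (hu : 0 ≤ u)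
    {s : ℂ} (hs : s ∈ rightHalfPlane 0) : Φ t (Φ u s) = Φ (t + u) s := by
  have hm := hΦ.mem le_rfl hu hs
  refine (hΦ.trajectory _ hm).eq_of_eq_zero hH ((hΦ.trajectory s hs).shift hu) ?_ ?_ ht
  · simpa only [hΦ.zero _ hm] using hm
  · simp only [hΦ.zero _ hm, zero_add]

theorem norm_sub_le (hΦ : IsForwardFlow H Φ) {ε : ℝ} (hε : 0 ≤ ε) {C : ℝ≥0}
    (hC : ∀ s ∈ rightHalfPlane ε, ‖H s‖ ≤ C) {s : ℂ} (hs : s ∈ rightHalfPlane ε) {t : ℝ}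
    (ht : 0 ≤ t) : ‖Φ t s - s‖ ≤ C * t := by
  have hs0 := rightHalfPlane_subset hε hs
  have := (hΦ.trajectory s hs0).norm_sub_le hC (by simpa only [hΦ.zero s hs0] using hs) ht
  rwa [hΦ.zero s hs0] at this

theorem norm_sub_eulerStep_le (hΦ : IsForwardFlow H Φ) {ε : ℝ} (hε : 0 ≤ ε) {C K : ℝ≥0}
    (hC : ∀ s ∈ rightHalfPlane ε, ‖H s‖ ≤ C) (hK : LipschitzOnWith K H (rightHalfPlane ε))
    {s : ℂ} (hs : s ∈ rightHalfPlane ε) {t : ℝ} (ht : 0 ≤ t) :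
    ‖Φ t s - eulerStep H t s‖ ≤ K * C * t ^ 2 := by
  have hs0 := rightHalfPlane_subset hε hs
  have := (hΦ.trajectory s hs0).norm_sub_euler_le hC hK
    (by simpa only [hΦ.zero s hs0] using hs) ht
  rwa [hΦ.zero s hs0] at this

/-- Discrete Grönwall inequality: a step adds a local error `K C h²` and amplifies the earlier error
by at most `1 + h K`. Each of the `k` local errors is crudely charged the full factor `(1 + h K) ^
k`. -/
theorem norm_sub_iterate_eulerStep_le (hH : IsTameField H) (hΦ : IsForwardFlow H Φ) {ε : ℝ}
    (hε : 0 ≤ ε) {C K : ℝ≥0} (hC : ∀ s ∈ rightHalfPlane ε, ‖H s‖ ≤ C)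
    (hK : LipschitzOnWith K H (rightHalfPlane ε)) {s : ℂ} (hs : s ∈ rightHalfPlane ε) {h : ℝ}
    (hh : 0 ≤ h) (k : ℕ) :
    ‖Φ (k * h) s - (eulerStep H h)^[k] s‖ ≤ k * (K * C * h ^ 2) * (1 + h * K) ^ k := by
  have hs0 := rightHalfPlane_subset hε hs
  induction k with
  | zero => simp [hΦ.zero s hs0]
  | succ k ih =>
    have hkh : 0 ≤ k * h := by positivity
    set y := Φ (k * h) s with hy
    set z := (eulerStep H h)^[k] s with hz
    have hym : y ∈ rightHalfPlane ε := hΦ.mem hε hkh hs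
    have hzm : z ∈ rightHalfPlane ε := (hH.mapsTo_eulerStep hε hh).iterate k hs
    have h1 : Φ ((k + 1 : ℕ) * h) s = Φ h y := by
      rw [hy, hΦ.comp hH hh hkh hs0]; push_cast; ring_nf
    have h2 : ‖eulerStep H h y - eulerStep H h z‖ ≤ (1 + h * K) * ‖y - z‖ := by
      have h3 := hK.dist_le_mul _ hym _ hzm
      rw [dist_eq_norm, dist_eq_norm] at h3
      calc ‖eulerStep H h y - eulerStep H h z‖ = ‖(y - z) + h * (H y - H z)‖ := by
            simp only [eulerStep]; congr 1; ring
        _ ≤ ‖y - z‖ + h * ‖H y - H z‖ := by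
            refine (norm_add_le _ _).trans ?_
            rw [norm_mul, Complex.norm_real, Real.norm_of_nonneg hh]
        _ ≤ ‖y - z‖ + h * (K * ‖y - z‖) := by gcongr
        _ = _ := by ring
    have h4 : (1 : ℝ) ≤ (1 + h * K) ^ (k + 1) := one_le_pow₀ (by
      have : 0 ≤ h * K := by positivity
      linarith)
    rw [h1, Function.iterate_succ_apply']
    calc ‖Φ h y - eulerStep H h z‖
        ≤ ‖Φ h y - eulerStep H h y‖ + ‖eulerStep H h y - eulerStep H h z‖ :=
          norm_sub_le_norm_sub_add_norm_sub _ _ _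
      _ ≤ K * C * h ^ 2 * 1 + (1 + h * K) * (k * (K * C * h ^ 2) * (1 + h * K) ^ k) := by
          rw [mul_one]
          gcongr
          · exact hΦ.norm_sub_eulerStep_le hε hC hK hym hh
          · exact h2.trans (by gcongr)
      _ ≤ K * C * h ^ 2 * (1 + h * K) ^ (k + 1) +
          (1 + h * K) * (k * (K * C * h ^ 2) * (1 + h * K) ^ k) := by gcongr
      _ = _ := by push_cast; ring

/-- The explicit Euler method converges to the flow, uniformly on every smaller half-plane. -/
theorem tendstoUniformlyOn_eulerStep (hH : IsTameField H) (hΦ : IsForwardFlow H Φ) {ε : ℝ}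
    (hε : 0 < ε) {t : ℝ} (ht : 0 ≤ t) :
    TendstoUniformlyOn (fun n : ℕ => (eulerStep H (t / (n + 1 : ℕ)))^[n + 1]) (Φ t) atTop
      (rightHalfPlane ε) := by
  obtain ⟨C, hC⟩ := hH.bounded ε hε
  obtain ⟨K, hK⟩ := hH.lipschitz ε hε
  have hb : ∀ (n : ℕ), ∀ s ∈ rightHalfPlane ε,
      ‖Φ t s - (eulerStep H (t / (n + 1 : ℕ)))^[n + 1] s‖ ≤
        K * C * t ^ 2 * Real.exp (t * K) * (1 / ((n : ℝ) + 1)) := by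
    intro n s hs
    have hn : (0 : ℝ) < (n + 1 : ℕ) := by positivity
    have h1 := hΦ.norm_sub_iterate_eulerStep_le hH hε.le hC hK hs (div_nonneg ht hn.le) (n + 1)
    rw [mul_div_cancel₀ _ hn.ne'] at h1
    refine h1.trans ?_
    have h2 : (1 + t / (n + 1 : ℕ) * K) ^ (n + 1) ≤ Real.exp (t * K) := by
      have h3 : (1 + t / (n + 1 : ℕ) * K) ≤ Real.exp (t / (n + 1 : ℕ) * K) := by
        rw [add_comm]; exact Real.add_one_le_exp _
      refine (pow_le_pow_left₀ (by positivity) h3 _).trans_eq ?_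
      rw [← Real.exp_nat_mul]
      congr 1
      field_simp
    calc _ ≤ (n + 1 : ℕ) * (K * C * (t / (n + 1 : ℕ)) ^ 2) * Real.exp (t * K) := by gcongr
      _ = _ := by push_cast at hn ⊢; field_simp
  have hlim : Tendsto (fun n : ℕ => K * C * t ^ 2 * Real.exp (t * K) * (1 / ((n : ℝ) + 1))) atTop
      (𝓝 0) := by
    simpa using tendsto_one_div_add_atTop_nhds_zero_nat.const_mul (K * C * t ^ 2 * Real.exp (t * K))
  rw [Metric.tendstoUniformlyOn_iff]
  intro δ hδ
  filter_upwards [hlim.eventually_lt_const hδ] with n hn s hs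
  rw [dist_eq_norm]
  exact (hb n s hs).trans_lt hn

/-- Weierstrass's theorem on the analytic Euler iterates replaces differentiation of the flow in its
initial value. -/
theorem isAnalyticSelfMap (hH : IsTameField H) (hΦ : IsForwardFlow H Φ) {t : ℝ} (ht : 0 ≤ t) :
    IsAnalyticSelfMap (Φ t) where
  analytic := by
    have hl : TendstoLocallyUniformlyOn
        (fun n : ℕ => (eulerStep H (t / (n + 1 : ℕ)))^[n + 1]) (Φ t) atTop (rightHalfPlane 0) := by
      rw [tendstoLocallyUniformlyOn_iff_forall_isCompact (isOpen_rightHalfPlane 0)]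
      intro K hK hc
      obtain ⟨ε, hε, hKε⟩ := exists_subset_rightHalfPlane hK hc
      exact (hΦ.tendstoUniformlyOn_eulerStep hH hε ht).mono hKε
    exact hl.differentiableOn (Eventually.of_forall fun n =>
      hH.differentiableOn_iterate_eulerStep (by positivity) _) (isOpen_rightHalfPlane 0)
  mapsTo _ hs := hΦ.mem le_rfl ht hs

theorem isContinuousSemigroup (hH : IsTameField H) (hΦ : IsForwardFlow H Φ) :
    IsContinuousSemigroup Φ where
  selfMap _ ht := hΦ.isAnalyticSelfMap hH ht
  zero := hΦ.zero
  comp _ _ ht hu _ hs := hΦ.comp hH ht hu hs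
  continuous K hK hc := by
    obtain ⟨ε, hε, hKε⟩ := exists_subset_rightHalfPlane hK hc
    obtain ⟨C, hC⟩ := hH.bounded ε hε
    have hlim : Tendsto (fun t : ℝ => C * t) (𝓝[>] 0) (𝓝 0) := by
      have : Tendsto (fun t : ℝ => C * t) (𝓝 0) (𝓝 (C * 0)) := tendsto_id.const_mul _
      rw [mul_zero] at this
      exact this.mono_left nhdsWithin_le_nhds
    rw [Metric.tendstoUniformlyOn_iff]
    intro δ hδ
    filter_upwards [hlim.eventually_lt_const hδ, self_mem_nhdsWithin] with t ht ht0 s hs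
    rw [hΦ.zero s (hK hs), dist_comm, dist_eq_norm]
    exact (hΦ.norm_sub_le hε.le hC (hKε hs) (le_of_lt ht0)).trans_lt ht

theorem isInfinitesimalGenerator (hH : IsTameField H) (hΦ : IsForwardFlow H Φ) :
    IsInfinitesimalGenerator H Φ := by
  intro S hS hc
  obtain ⟨ε, hε, hSε⟩ := exists_subset_rightHalfPlane hS hc
  obtain ⟨C, hC⟩ := hH.bounded ε hε
  obtain ⟨K, hK⟩ := hH.lipschitz ε hε
  have hlim : Tendsto (fun t : ℝ => K * C * t) (𝓝[>] 0) (𝓝 0) := by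
    have : Tendsto (fun t : ℝ => K * C * t) (𝓝 0) (𝓝 (K * C * 0)) := tendsto_id.const_mul _
    rw [mul_zero] at this
    exact this.mono_left nhdsWithin_le_nhds
  rw [Metric.tendstoUniformlyOn_iff]
  intro δ hδ
  filter_upwards [hlim.eventually_lt_const hδ, self_mem_nhdsWithin] with t ht ht0 s hs
  have ht0' : 0 < t := ht0
  have htc : (t : ℂ) ≠ 0 := by exact_mod_cast ht0'.ne'
  have h1 := hΦ.norm_sub_eulerStep_le hε.le hC hK (hSε hs) ht0'.le
  rw [dist_comm, dist_eq_norm]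
  refine lt_of_le_of_lt ?_ ht
  have h2 : (Φ t s - s) / t - H s = (Φ t s - eulerStep H t s) / t := by
    simp only [eulerStep]; field_simp; ring
  rw [h2, norm_div, Complex.norm_real, Real.norm_of_nonneg ht0'.le, div_le_iff₀ ht0']
  exact h1.trans_eq (by ring)

end IsForwardFlow

/-! ### Norm balls of Dirichlet polynomials and their pointwise closures. -/

/-- Dirichlet polynomials `∑ c_i m_i^{-s}` on `ℂ_σ` with `∑ |c_i| m_i^{-σ} ≤ M`. -/
def dirichletPolynomialBall (σ M : ℝ) : Set (rightHalfPlane σ → ℂ) :=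
  {f | ∃ (ι : Type) (_ : Fintype ι) (c : ι → ℂ) (m : ι → ℕ), (∀ i, m i ≠ 0) ∧
    ∑ i, ‖c i‖ * (m i : ℝ) ^ (-σ) ≤ M ∧ ∀ s, f s = ∑ i, c i * (m i : ℂ) ^ (-(s : ℂ))}

/-- Pointwise limits on `ℂ_σ` of Dirichlet polynomials `∑ c_i m_i^{-s}` with
`∑ |c_i| m_i^{-σ} ≤ M`. -/
def dirichletBall (σ M : ℝ) : Set (rightHalfPlane σ → ℂ) :=
  closure (dirichletPolynomialBall σ M)

section dirichletBall

variable {σ M M' : ℝ} {f g : rightHalfPlane σ → ℂ}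

theorem dirichletBall_mono (h : M ≤ M') : dirichletBall σ M ⊆ dirichletBall σ M' :=
  closure_mono fun _ ⟨ι, hι, c, m, hm, hM, hf⟩ => ⟨ι, hι, c, m, hm, hM.trans h, hf⟩

/-- The function space has the product topology, so closure allows pointwise limits, with no
uniformity required. -/
theorem mem_dirichletBall_of_tendsto {ι : Type*} {l : Filter ι} [l.NeBot]
    {F : ι → rightHalfPlane σ → ℂ} (hF : ∀ i, F i ∈ dirichletBall σ M)
    (h : ∀ s, Tendsto (fun i => F i s) l (𝓝 (f s))) : f ∈ dirichletBall σ M :=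
  isClosed_closure.mem_of_tendsto (tendsto_pi_nhds.2 h) (Eventually.of_forall hF)

theorem monomial_mem_dirichletBall (c : ℂ) {n : ℕ} (hn : n ≠ 0) :
    (fun s : rightHalfPlane σ => c * (n : ℂ) ^ (-(s : ℂ))) ∈
      dirichletBall σ (‖c‖ * (n : ℝ) ^ (-σ)) :=
  subset_closure ⟨Unit, inferInstance, fun _ => c, fun _ => n, fun _ => hn, by simp, by simp⟩

theorem const_mem_dirichletBall (c : ℂ) :
    (fun _ : rightHalfPlane σ => c) ∈ dirichletBall σ ‖c‖ := by
  simpa using monomial_mem_dirichletBall (σ := σ) c one_ne_zero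

theorem add_mem_dirichletBall (hf : f ∈ dirichletBall σ M) (hg : g ∈ dirichletBall σ M') :
    f + g ∈ dirichletBall σ (M + M') := by
  refine map_mem_closure₂ continuous_add hf hg ?_
  rintro f ⟨ι, hι, c, m, hm, hM, hf⟩ g ⟨κ, hκ, d, k, hk, hM', hg⟩
  refine ⟨ι ⊕ κ, inferInstance, Sum.elim c d, Sum.elim m k, ?_, ?_, fun s => ?_⟩
  · rintro (i | j)
    exacts [hm i, hk j]
  · simpa using add_le_add hM hM'
  · simp [hf, hg]

/-- Frequencies multiply, and `(m k)^{-σ} = m^{-σ} k^{-σ}` makes the norm submultiplicative. -/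
theorem mul_mem_dirichletBall (hf : f ∈ dirichletBall σ M) (hg : g ∈ dirichletBall σ M') :
    f * g ∈ dirichletBall σ (M * M') := by
  refine map_mem_closure₂ continuous_mul hf hg ?_
  rintro f ⟨ι, hι, c, m, hm, hM, hf⟩ g ⟨κ, hκ, d, k, hk, hM', hg⟩
  refine ⟨ι × κ, inferInstance, fun p => c p.1 * d p.2, fun p => m p.1 * k p.2,
    fun p => mul_ne_zero (hm _) (hk _), ?_, fun s => ?_⟩
  · refine le_trans (le_of_eq ?_) (mul_le_mul hM hM' (by positivity)
      (le_trans (by positivity) hM))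
    rw [Finset.sum_mul_sum, ← Finset.univ_product_univ, Finset.sum_product]
    refine Finset.sum_congr rfl fun i _ => Finset.sum_congr rfl fun j _ => ?_
    rw [norm_mul, Nat.cast_mul, Real.mul_rpow (Nat.cast_nonneg _) (Nat.cast_nonneg _)]
    ring
  · rw [Pi.mul_apply, hf, hg, Finset.sum_mul_sum, ← Finset.univ_product_univ, Finset.sum_product]
    refine Finset.sum_congr rfl fun i _ => Finset.sum_congr rfl fun j _ => ?_
    rw [Nat.cast_mul, Complex.natCast_mul_natCast_cpow]
    ring

theorem pow_mem_dirichletBall (hf : f ∈ dirichletBall σ M) (k : ℕ) :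
    f ^ k ∈ dirichletBall σ (M ^ k) := by
  induction k with
  | zero => simpa [Pi.one_def] using const_mem_dirichletBall (σ := σ) 1
  | succ k ih => simpa only [pow_succ] using mul_mem_dirichletBall ih hf

theorem sum_mem_dirichletBall {ι : Type*} (S : Finset ι) {F : ι → rightHalfPlane σ → ℂ}
    {B : ι → ℝ} (h : ∀ i ∈ S, F i ∈ dirichletBall σ (B i)) :
    ∑ i ∈ S, F i ∈ dirichletBall σ (∑ i ∈ S, B i) := by
  classical
  induction S using Finset.induction_on with
  | empty => simpa [Pi.zero_def] using const_mem_dirichletBall (σ := σ) 0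
  | insert i S hi ih =>
    rw [Finset.sum_insert hi, Finset.sum_insert hi]
    exact add_mem_dirichletBall (h i (Finset.mem_insert_self i S))
      (ih fun j hj => h j (Finset.mem_insert_of_mem hj))

theorem nonneg_of_mem_dirichletBall (hf : f ∈ dirichletBall σ M) : 0 ≤ M := by
  obtain ⟨_, ι, hι, c, m, -, hM, -⟩ := closure_nonempty_iff.1 ⟨f, hf⟩
  exact le_trans (by positivity) hM

/-- `(1 + f/n)^n` tends to `exp f` and has norm at most `(1 + M/n)^n ≤ exp M`. -/
theorem exp_mem_dirichletBall (hf : f ∈ dirichletBall σ M) :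
    (fun s => Complex.exp (f s)) ∈ dirichletBall σ (Real.exp M) := by
  have hM := nonneg_of_mem_dirichletBall hf
  refine mem_dirichletBall_of_tendsto (l := atTop)
    (F := fun (n : ℕ) => ((fun _ => 1) + (fun _ => ((n : ℂ))⁻¹) * f) ^ n) (fun n => ?_) fun s => ?_
  · refine dirichletBall_mono ?_ (pow_mem_dirichletBall (add_mem_dirichletBall
      (const_mem_dirichletBall 1) (mul_mem_dirichletBall (const_mem_dirichletBall _) hf)) n)
    rw [norm_one, norm_inv, Complex.norm_natCast]
    rcases eq_or_ne n 0 with rfl | hn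
    · simpa using hM
    · calc (1 + (n : ℝ)⁻¹ * M) ^ n ≤ Real.exp ((n : ℝ)⁻¹ * M) ^ n := by
            refine pow_le_pow_left₀ (by positivity) ?_ n
            rw [add_comm]; exact Real.add_one_le_exp _
        _ = Real.exp M := by
            rw [← Real.exp_nat_mul, mul_inv_cancel_left₀ (Nat.cast_ne_zero.2 hn)]
  · have := Complex.tendsto_one_add_div_pow_exp (f s)
    refine this.congr fun n => ?_
    simp only [Pi.pow_apply, Pi.add_apply, Pi.mul_apply, div_eq_inv_mul]

/-- Composition of an absolutely convergent Dirichlet series with `s + ψ(s)`. -/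
theorem comp_mem_dirichletBall {H : ℂ → ℂ} {a : ℕ → ℂ} {σ₀ K : ℝ}
    (ha : ∀ N : ℕ, ∑ n ∈ Finset.Icc 1 N, ‖a n‖ * (n : ℝ) ^ (-σ₀) ≤ K)
    (hH : ∀ s ∈ rightHalfPlane σ₀,
      Tendsto (fun N : ℕ => ∑ n ∈ Finset.Icc 1 N, a n * (n : ℂ) ^ (-s)) atTop (𝓝 (H s)))
    (hσ : σ = σ₀ + M) {ψ : rightHalfPlane σ → ℂ} (hψ : ψ ∈ dirichletBall σ M)
    (hmem : ∀ s : rightHalfPlane σ, (s : ℂ) + ψ s ∈ rightHalfPlane σ₀) :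
    (fun s : rightHalfPlane σ => H (s + ψ s)) ∈ dirichletBall σ K := by
  refine mem_dirichletBall_of_tendsto (l := atTop) (F := fun (N : ℕ) => ∑ n ∈ Finset.Icc 1 N,
    fun s : rightHalfPlane σ => a n * (n : ℂ) ^ (-((s : ℂ) + ψ s))) (fun N => ?_) fun s => ?_
  · refine dirichletBall_mono (ha N) (sum_mem_dirichletBall _ fun n hn => ?_)
    have hn0 : n ≠ 0 := (Nat.one_le_iff_ne_zero.1 (Finset.mem_Icc.1 hn).1)
    have hnR : (0 : ℝ) < n := Nat.cast_pos.2 (Nat.pos_of_ne_zero hn0)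
    have hlog : 0 ≤ Real.log n := Real.log_natCast_nonneg n
    -- `n^{-(s+ψ)} = n^{-s} exp(-ψ log n)` has norm at most `n^{-σ} n^M = n^{-σ₀}`.
    have h1 := mul_mem_dirichletBall (monomial_mem_dirichletBall (σ := σ) (a n) hn0)
      (exp_mem_dirichletBall
        (mul_mem_dirichletBall (const_mem_dirichletBall (-(Real.log n : ℂ))) hψ))
    convert h1 using 1
    · rw [norm_neg, Complex.norm_real, Real.norm_of_nonneg hlog, mul_assoc,
        Real.rpow_def_of_pos hnR, Real.rpow_def_of_pos hnR, ← Real.exp_add, hσ]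
      ring_nf
    · funext s
      simp only [Pi.mul_apply]
      rw [neg_add, Complex.cpow_add _ _ (Nat.cast_ne_zero.2 hn0), mul_assoc,
        Complex.cpow_def_of_ne_zero (Nat.cast_ne_zero.2 hn0) (-ψ s), Complex.natCast_log]
      ring_nf
  · simpa only [Finset.sum_apply] using hH _ (hmem s)

theorem sum_Icc_one_eq_sum_range {A : Type*} [AddCommMonoid A] (u : ℕ → A) (N : ℕ) :
    ∑ n ∈ Finset.Icc 1 N, u n = ∑ n ∈ Finset.range N, u (n + 1) := by
  induction N with
  | zero => simp
  | succ N ih => rw [Finset.sum_Icc_succ_top (by omega), ih, Finset.sum_range_succ]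

theorem norm_mul_succ_cpow_le {b : ℂ} {n : ℕ} (hM : 0 ≤ M) (hb : ‖b‖ ≤ M * ((n : ℝ) + 1) ^ σ) {s : ℂ}
    (hs : s ∈ rightHalfPlane (σ + 2)) :
    ‖b * ((n + 1 : ℕ) : ℂ) ^ (-s)‖ ≤ M * (1 / ((n : ℝ) + 1) ^ 2) := by
  have hs' : σ + 2 < s.re := hs
  have hn : (0 : ℝ) < (n : ℝ) + 1 := by positivity
  have hn1 : (1 : ℝ) ≤ (n : ℝ) + 1 := by simp
  rw [norm_mul, Complex.norm_natCast_cpow_of_pos n.succ_pos, Complex.neg_re, Nat.cast_add_one]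
  calc ‖b‖ * ((n : ℝ) + 1) ^ (-s.re) ≤ M * ((n : ℝ) + 1) ^ σ * ((n : ℝ) + 1) ^ (-s.re) := by gcongr
    _ = M * ((n : ℝ) + 1) ^ (σ - s.re) := by rw [mul_assoc, ← Real.rpow_add hn, sub_eq_add_neg]
    _ ≤ M * ((n : ℝ) + 1) ^ (-2 : ℝ) := by gcongr; linarith
    _ = M * (1 / ((n : ℝ) + 1) ^ 2) := by
      rw [Real.rpow_neg hn.le, one_div]; norm_cast

theorem summable_const_mul_one_div_succ_sq (M : ℝ) :
    Summable fun n : ℕ => M * (1 / ((n : ℝ) + 1) ^ 2) := by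
  have h := (summable_nat_add_iff 1).2 (Real.summable_one_div_nat_pow.2 one_lt_two)
  exact (by simpa using h : Summable fun n : ℕ => 1 / ((n : ℝ) + 1) ^ 2).mul_left M

/-- The elements of `dirichletBall σ M` are sums of Dirichlet series on `ℂ_{σ+2}`. -/
theorem exists_hasSum_of_mem_dirichletBall (hf : f ∈ dirichletBall σ M) :
    ∃ b : ℕ → ℂ, ∀ s : rightHalfPlane σ, (s : ℂ) ∈ rightHalfPlane (σ + 2) →
      HasSum (fun n => b n * ((n + 1 : ℕ) : ℂ) ^ (-(s : ℂ))) (f s) := by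
  have hM := nonneg_of_mem_dirichletBall hf
  have hsub : ∀ s : rightHalfPlane (σ + 2), (s : ℂ) ∈ rightHalfPlane σ := fun s =>
    rightHalfPlane_subset (by linarith) s.2
  set R : (rightHalfPlane σ → ℂ) → (rightHalfPlane (σ + 2) → ℂ) :=
    fun g s => g ⟨s, hsub s⟩ with hR
  have hRc : Continuous R := continuous_pi fun s => continuous_apply _
  -- Index `n` stands for the integer `n + 1`, whose coefficient is at most `M (n + 1)^σ`. The box
  -- is compact by Tychonoff and `T` is continuous on it by the M-test, so its image is closed and
  -- contains the limits of polynomials.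
  set box : Set (ℕ → ℂ) :=
    Set.pi Set.univ fun n : ℕ => Metric.closedBall 0 (M * ((n : ℝ) + 1) ^ σ) with hbox
  set T : (ℕ → ℂ) → (rightHalfPlane (σ + 2) → ℂ) :=
    fun b s => ∑' n, b n * ((n + 1 : ℕ) : ℂ) ^ (-(s : ℂ)) with hT
  have hbound : ∀ b ∈ box, ∀ (s : rightHalfPlane (σ + 2)) (n : ℕ),
      ‖b n * ((n + 1 : ℕ) : ℂ) ^ (-(s : ℂ))‖ ≤ M * (1 / ((n : ℝ) + 1) ^ 2) := fun b hb s n =>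
    norm_mul_succ_cpow_le hM (mem_closedBall_zero_iff.1 (hb n trivial)) s.2
  have hTc : ContinuousOn T box := continuousOn_pi.2 fun s =>
    continuousOn_tsum (fun n => ((continuous_apply n).mul continuous_const).continuousOn)
      (summable_const_mul_one_div_succ_sq M) fun n b hb => hbound b hb s n
  have hclosed : IsClosed (T '' box) :=
    ((isCompact_univ_pi fun n => isCompact_closedBall _ _).image_of_continuousOn hTc).isClosed
  have hpoly : Set.MapsTo R (dirichletPolynomialBall σ M) (T '' box) := by
    rintro g ⟨ι, hι, c, m, hm, hcM, hg⟩
    -- Frequencies may repeat, so equal ones are collected.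
    refine ⟨fun n => ∑ i, if m i = n + 1 then c i else 0, fun n _ => ?_, ?_⟩
    · rw [mem_closedBall_zero_iff]
      have hn : (0 : ℝ) < (n : ℝ) + 1 := by positivity
      calc ‖∑ i, if m i = n + 1 then c i else 0‖
          ≤ ∑ i, ‖c i‖ * (m i : ℝ) ^ (-σ) * ((n : ℝ) + 1) ^ σ := by
            refine (norm_sum_le _ _).trans (Finset.sum_le_sum fun i _ => ?_)
            split_ifs with h
            · rw [h, mul_assoc, Nat.cast_add_one, ← Real.rpow_add hn]
              simp
            · rw [norm_zero]
              positivity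
        _ = (∑ i, ‖c i‖ * (m i : ℝ) ^ (-σ)) * ((n : ℝ) + 1) ^ σ := by rw [Finset.sum_mul]
        _ ≤ _ := by gcongr
    · funext s
      have h1 : HasSum (fun n => ∑ i, (if m i = n + 1 then c i else 0) *
          ((n + 1 : ℕ) : ℂ) ^ (-(s : ℂ))) (∑ i, c i * (m i : ℂ) ^ (-(s : ℂ))) := by
        refine hasSum_sum fun i _ => ?_
        have hmi : m i - 1 + 1 = m i := Nat.succ_pred_eq_of_ne_zero (hm i)
        have h2 := hasSum_single (f := fun n => (if m i = n + 1 then c i else 0) *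
          ((n + 1 : ℕ) : ℂ) ^ (-(s : ℂ))) (m i - 1) fun n hn => by
            rw [if_neg (by omega), zero_mul]
        simpa only [hmi, if_true] using h2
      simp only [hT, hR, hg, Finset.sum_mul]
      exact h1.tsum_eq
  obtain ⟨b, hb, hbf⟩ : R f ∈ T '' box := by
    have := map_mem_closure hRc hf hpoly
    rwa [hclosed.closure_eq] at this
  refine ⟨b, fun s hs => ?_⟩
  have h1 := congrFun hbf ⟨s, hs⟩
  simp only [hT, hR] at h1
  rw [← h1]
  exact (Summable.of_norm_bounded (summable_const_mul_one_div_succ_sq M)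
    (hbound b hb ⟨s, hs⟩)).hasSum

theorem isDirichletSeries_of_mem_dirichletBall {F : ℂ → ℂ}
    (hF : (fun s : rightHalfPlane σ => F s) ∈ dirichletBall σ M) : IsDirichletSeries F := by
  obtain ⟨b, hb⟩ := exists_hasSum_of_mem_dirichletBall hF
  refine ⟨fun n => b (n - 1), σ + 2, fun s hs => ?_⟩
  have h1 := (hb ⟨s, rightHalfPlane_subset (by linarith) hs⟩ hs).tendsto_sum_nat
  refine h1.congr fun N => ?_
  rw [sum_Icc_one_eq_sum_range]
  rfl

end dirichletBall

/-! ### The Dirichlet series of the flow. -/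

/-- A Dirichlet series converging somewhere converges absolutely in a smaller half-plane. -/
theorem IsDirichletSeries.exists_abs_bound {H : ℂ → ℂ} (hH : IsDirichletSeries H) :
    ∃ (a : ℕ → ℂ) (σ K : ℝ), 0 ≤ σ ∧ 0 ≤ K ∧
      (∀ N : ℕ, ∑ n ∈ Finset.Icc 1 N, ‖a n‖ * (n : ℝ) ^ (-σ) ≤ K) ∧
      ∀ s ∈ rightHalfPlane σ,
        Tendsto (fun N : ℕ => ∑ n ∈ Finset.Icc 1 N, a n * (n : ℂ) ^ (-s)) atTop (𝓝 (H s)) := by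
  obtain ⟨a, θ, ha⟩ := hH
  have hs : ((θ + 1 : ℝ) : ℂ) ∈ rightHalfPlane θ := by
    change θ < ((θ + 1 : ℝ) : ℂ).re
    rw [Complex.ofReal_re]
    linarith
  obtain ⟨C, hC⟩ := (Metric.isBounded_range_of_tendsto _ (ha _ hs)).exists_norm_le
  -- A term is the difference of two consecutive partial sums, which are bounded at the point `θ +
  -- 1`.
  have hterm : ∀ n : ℕ, ‖a (n + 1)‖ * ((n : ℝ) + 1) ^ (-(θ + 1)) ≤ C + C := by
    intro n
    have h1 := norm_sub_le_of_le (hC _ ⟨n + 1, rfl⟩) (hC _ ⟨n, rfl⟩)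
    beta_reduce at h1
    rw [Finset.sum_Icc_succ_top (by omega), add_sub_cancel_left, norm_mul,
      Complex.norm_natCast_cpow_of_pos n.succ_pos, Complex.neg_re, Complex.ofReal_re,
      Nat.cast_add_one] at h1
    exact h1
  have hC0 : 0 ≤ C := (norm_nonneg _).trans (hC _ ⟨0, rfl⟩)
  -- One unit reaches the point of convergence and two more give the summable factor `1 / (n + 1)²`.
  -- The maximum keeps the half-plane inside `ℂ_+`.
  refine ⟨a, max θ 0 + 3, ∑' n : ℕ, (C + C) * (1 / ((n : ℝ) + 1) ^ 2), by positivity,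
    tsum_nonneg fun n => by positivity, fun N => ?_, fun s hs => ha s
      (rightHalfPlane_subset (by linarith [le_max_left θ 0]) hs)⟩
  rw [sum_Icc_one_eq_sum_range]
  refine le_trans (Finset.sum_le_sum fun n _ => ?_)
    ((summable_const_mul_one_div_succ_sq (C + C)).sum_le_tsum _ fun n _ => by positivity)
  have hn : (0 : ℝ) < (n : ℝ) + 1 := by positivity
  have hn1 : (1 : ℝ) ≤ (n : ℝ) + 1 := by simp
  calc ‖a (n + 1)‖ * ((n + 1 : ℕ) : ℝ) ^ (-(max θ 0 + 3))
      ≤ ‖a (n + 1)‖ * ((n : ℝ) + 1) ^ (-(θ + 1) + (-2 : ℝ)) := by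
        rw [Nat.cast_add_one]
        gcongr
        linarith [le_max_left θ 0]
    _ = ‖a (n + 1)‖ * ((n : ℝ) + 1) ^ (-(θ + 1)) * (1 / ((n : ℝ) + 1) ^ 2) := by
        rw [Real.rpow_add hn, ← mul_assoc, Real.rpow_neg hn.le 2, one_div]
        norm_cast
    _ ≤ _ := by gcongr; exact hterm n

theorem IsForwardFlow.isDirichletSeries_sub_id {H : ℂ → ℂ} {Φ : ℝ → ℂ → ℂ} (hH : IsTameField H)
    (hΦ : IsForwardFlow H Φ) (hD : IsDirichletSeries H) {t : ℝ} (ht : 0 ≤ t) :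
    IsDirichletSeries fun s => Φ t s - s := by
  obtain ⟨a, σ₀, K, hσ₀, hK, ha, haH⟩ := hD.exists_abs_bound
  -- Each Euler step adds at most `h K` to the norm of the displacement, hence at most `t K` in
  -- total. This shift of the abscissa therefore serves every step size.
  set σ := σ₀ + t * K with hσ
  have hσ₀σ : σ₀ ≤ σ := by
    have := mul_nonneg ht hK
    linarith
  have hstep : ∀ n k : ℕ, k ≤ n + 1 →
      (fun s : rightHalfPlane σ => (eulerStep H (t / (n + 1 : ℕ)))^[k] (s : ℂ) - s) ∈
        dirichletBall σ (k * (t / (n + 1 : ℕ)) * K) := by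
    intro n k hk
    have hn : (0 : ℝ) < (n + 1 : ℕ) := by positivity
    set h : ℝ := t / (n + 1 : ℕ) with hh
    have hh0 : 0 ≤ h := div_nonneg ht hn.le
    induction k with
    | zero => simpa using const_mem_dirichletBall (σ := σ) 0
    | succ k ih =>
      have ih' := ih (by omega)
      have hkM : k * h * K ≤ t * K := by
        gcongr
        calc k * h ≤ (n + 1 : ℕ) * h := by gcongr; omega
          _ = t := mul_div_cancel₀ _ hn.ne'
      have hc := comp_mem_dirichletBall ha haH hσ (dirichletBall_mono hkM ih') fun s => by
        rw [add_sub_cancel]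
        exact rightHalfPlane_subset hσ₀σ
          ((hH.mapsTo_eulerStep (hσ₀.trans hσ₀σ) hh0).iterate k s.2)
      have := add_mem_dirichletBall ih'
        (mul_mem_dirichletBall (const_mem_dirichletBall (h : ℂ)) hc)
      convert this using 1
      · rw [Complex.norm_real, Real.norm_of_nonneg hh0]
        push_cast
        congr 1
        ring
      · funext s
        simp only [Pi.add_apply, Pi.mul_apply, add_sub_cancel, Function.iterate_succ_apply',
          eulerStep]
        ring
  refine isDirichletSeries_of_mem_dirichletBall (σ := σ) (M := t * K)
    (mem_dirichletBall_of_tendsto (l := atTop) (F := fun (n : ℕ) (s : rightHalfPlane σ) =>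
      (eulerStep H (t / (n + 1 : ℕ)))^[n + 1] (s : ℂ) - s) (fun n => ?_) fun s => ?_)
  · have hn : ((n + 1 : ℕ) : ℝ) ≠ 0 := by positivity
    simpa only [mul_div_cancel₀ _ hn] using hstep n (n + 1) le_rfl
  · have hs : 0 < (s : ℂ).re := (hσ₀.trans hσ₀σ).trans_lt s.2
    exact ((hΦ.tendstoUniformlyOn_eulerStep hH (half_pos hs) ht).tendsto_at
      (half_lt_self hs)).sub_const _

theorem theorem5p5 (H : ℂ → ℂ)
    (hH : DifferentiableOn ℂ H (rightHalfPlane 0))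
    (hmaps : Set.MapsTo H (rightHalfPlane 0) (closure (rightHalfPlane 0)))
    (hbdd : ∀ σ : ℝ, 0 < σ → MemHInfty (1 / 2 + σ) H) :
    ∃ Φ φ : ℝ → ℂ → ℂ,
      IsContinuousSemigroup Φ ∧
      IsInfinitesimalGenerator H Φ ∧
      (∀ t : ℝ, 0 ≤ t → IsDirichletSeries (φ t) ∧
        ∀ s ∈ rightHalfPlane 0, Φ t s = s + φ t s) ∧
      (∀ t : ℝ, 0 ≤ t → MemGordonHedenmalm (Φ t)) := by
  -- The value `σ = 1/2` gives the bound on `ℂ_1` from which Borel–Carathéodory starts.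
  have h1 := hbdd (1 / 2) one_half_pos
  obtain ⟨B, hB⟩ := h1.bounded
  rw [add_halves] at hB
  have hT : IsTameField H := isTameField_of_re_nonneg hH
    (fun s hs => re_nonneg_of_mem_closure_rightHalfPlane (hmaps hs)) hB
  obtain ⟨Φ, hΦ⟩ := hT.exists_isForwardFlow
  have hD : ∀ t : ℝ, 0 ≤ t → IsDirichletSeries fun s => Φ t s - s := fun t ht =>
    hΦ.isDirichletSeries_sub_id hT h1.dirichlet ht
  refine ⟨Φ, fun t s => Φ t s - s, hΦ.isContinuousSemigroup hT, hΦ.isInfinitesimalGenerator hT,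
    fun t ht => ⟨hD t ht, fun s _ => (add_sub_cancel s (Φ t s)).symm⟩, fun t ht =>
      ⟨hΦ.isAnalyticSelfMap hT ht, 1, fun s => Φ t s - s, hD t ht, fun s _ => by simp, fun h => absurd h one_ne_zero⟩⟩
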